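/- Let $n\ge 2$. Two graphs $G,G'$ on the node set $[n]$ are node-adjacent ($G\sim G'$) if for some node $i$ every edge in their symmetric difference is incident on $i$. A randomized algorithm $\mathcal A$ taking $n$-node graphs to $\mathbb R$ is $(\epsilon,\delta)$-node-differentially private if $\Pr[\mathcal A(G)\in R]\le e^{\epsilon}\Pr[\mathcal A(G')\in R]+\delta$ for all $G\sim G'$ and all measurable $R\subseteq\mathbb R$. For $f$ from $n$-node graphs to $\mathbb R$ let $LS_f(G)=\max_{G'\sim G}|f(G)-f(G')|$; a function $S$ is a $\beta$-smooth upper bound on $LS_f$ if $S\ge LS_f$ and $S(G)\le e^{\beta}S(G')$ for all $G\sim G'$. For a graph $G=(V,E)$ on $n$ nodes let $p_G=|E|/\binom n2$ and $\bar d_G=(n-1)p_G=2|E|/n$. For real $k$, $G$ is $k$-concentrated if all its degrees lie in $[\bar d_G-k,\bar d_G+k]$. Fix a constant $c>0$. Given $G$ and parameters $\epsilon>0$, $k^*\ge 0$, the algorithm $\mathcal A_{\epsilon,k^*}$ does the following. 1. Let $\beta=\min(\epsilon,1/\sqrt{k^*})$ (with $1/\sqrt 0=\infty$), and let $k_G$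 be the smallest positive integer such that at most $k_G$ vertices have degree outside $I_G=[\bar d_G-k^*-3k_G,\ \bar d_G+k^*+3k_G]$. 2. For $v\in V$ let $t_v$ be the distance from $\deg_G(v)$ to $I_G$ and $\mathsf{wt}_G(v)=\max(0,1-\beta t_v)$. For $e=\{u,v\}$ let $\mathsf{wt}_G(e)=\min(\mathsf{wt}_G(u),\mathsf{wt}_G(v))$ and $\mathsf{val}_G(e)=\mathsf{wt}_G(e)\,x_e+(1-\mathsf{wt}_G(e))\,p_G$, where $x_e\in\{0,1\}$ indicates $e\in E$. Let $f(G)=\sum_{e}\mathsf{val}_G(e)$, over all unordered pairs $e$ of distinct vertices. 3. Let $g(x)=(x+k^*)(1+\beta x)+1/\beta$ and $s=S(G)=\max_{\ell\in\mathbb Z_{\ge 0}}c\,e^{-\beta\ell}\,g(k_G+\ell)$. 4. Return $\frac{1}{\binom n2}\bigl(f(G)+\frac{s}{\epsilon}Z\bigr)$, where $Z$ has Student's $t$-distribution with three degrees of freedom. Theorem. There is an absolute constant $c_0>0$ such that $LS_f(G)\le c_0\,g(k_G)$ for all $n\ge2$, all $n$-node graphs $G$, all $k^*\ge0$ and all $\beta>0$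 (with $f$, $g$ formed with these $k^*,\beta$). Moreover, for every constant $c\ge c_0$ there is a constant $C>0$, depending only on $c$, such that: (a) for all $n\ge2$, $\epsilon>0$ and $k^*\ge0$, the function $S$ is a $\beta$-smooth upper bound on $LS_f$, and $\mathcal A_{\epsilon,k^*}$ is $(C\epsilon,0)$-node-differentially private; (b) for all $n\ge2$, $\epsilon>0$, $k\ge1$, $k^*\ge k$ and every $k$-concentrated $n$-node graph $G$, $$\mathbb E\bigl[(p_G-\mathcal A_{\epsilon,k^*}(G))^2\bigr]\le C\left(\frac{(k^*)^2}{\epsilon^2n^4}+\frac{1}{\epsilon^4n^4}\right).$$ In particular, for $k^*=k$ the mean squared error is $O\!\left(\frac{k^2}{\epsilon^2n^4}+\frac1{\epsilon^4n^4}\right)$. -/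

import Mathlib

open MeasureTheory

/-- Two graphs on the same `n` nodes are node-adjacent if there is a node `i` such that every edge in
the symmetric difference of the two graphs is incident on `i`. -/
def NodeAdjacent {n : ℕ} (G G' : SimpleGraph (Fin n)) : Prop :=
  ∃ i : Fin n, ∀ u v : Fin n, u ≠ i → v ≠ i → (G.Adj u v ↔ G'.Adj u v)

/-- `(ε, δ)`-node-differential privacy of a randomized real-valued algorithm, given by the law `A G` of
its output on each input graph `G`. -/
def IsNodeDP {n : ℕ} (ε δ : ℝ) (A : SimpleGraph (Fin n) → Measure ℝ) : Prop :=
  ∀ G G' : SimpleGraph (Fin n), NodeAdjacent G G' → ∀ R : Set ℝ, MeasurableSet R →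
    A G R ≤ ENNReal.ofReal (Real.exp ε) * A G' R + ENNReal.ofReal δ

/-- The local sensitivity of `f` at `G`: the maximum of `|f G - f G'|` over the (finitely many) graphs `G'`
that are node-adjacent to `G`. -/
noncomputable def localSensitivity {n : ℕ} (f : SimpleGraph (Fin n) → ℝ) (G : SimpleGraph (Fin n)) : ℝ :=
  ⨆ G' : {G' : SimpleGraph (Fin n) // NodeAdjacent G G'}, |f G - f G'|

/-- `S` is a `β`-smooth upper bound on the local sensitivity of `f`. -/
def IsSmoothUpperBound {n : ℕ} (β : ℝ) (f S : SimpleGraph (Fin n) → ℝ) : Prop :=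
  (∀ G, localSensitivity f G ≤ S G) ∧
    ∀ G G', NodeAdjacent G G' → S G ≤ Real.exp β * S G'

/-- The density of Student's t-distribution with three degrees of freedom. -/
noncomputable def studentT3Density (z : ℝ) : ℝ :=
  2 / (Real.sqrt 3 * Real.pi * (1 + z ^ 2 / 3) ^ 2)

/-- Student's t-distribution with three degrees of freedom. -/
noncomputable def studentT3 : Measure ℝ :=
  volume.withDensity fun z => ENNReal.ofReal (studentT3Density z)

section Graph

variable {n : ℕ}

/-- The number of edges `|E|`. -/
noncomputable def edgeCount (G : SimpleGraph (Fin n)) : ℕ := G.edgeSet.ncard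

/-- The degree of the vertex `v`. -/
noncomputable def nodeDegree (G : SimpleGraph (Fin n)) (v : Fin n) : ℕ := (G.neighborSet v).ncard

/-- The empirical edge density `p_G = |E| / C(n,2)`. -/
noncomputable def edgeDensity (G : SimpleGraph (Fin n)) : ℝ := (edgeCount G : ℝ) / (n.choose 2 : ℝ)

/-- The empirical average degree `(n - 1) p_G`. -/
noncomputable def avgDegree (G : SimpleGraph (Fin n)) : ℝ := ((n : ℝ) - 1) * edgeDensity G

/-- `G` is `k`-concentrated: every degree is within `k` of the average degree `2|E| / n`. -/
def IsConcentrated (k : ℝ) (G : SimpleGraph (Fin n)) : Prop :=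
  ∀ v : Fin n, (nodeDegree G v : ℝ) ∈
    Set.Icc (2 * (edgeCount G : ℝ) / (n : ℝ) - k) (2 * (edgeCount G : ℝ) / (n : ℝ) + k)

/-- The interval of all reals within `k* + 3 j` of the average degree. -/
noncomputable def degreeInterval (kstar : ℝ) (j : ℕ) (G : SimpleGraph (Fin n)) : Set ℝ :=
  Set.Icc (avgDegree G - (kstar + 3 * (j : ℝ))) (avgDegree G + (kstar + 3 * (j : ℝ)))

/-- `k_G`: the smallest positive integer `j` such that at most `j` vertices have their degree outside the
interval of radius `k* + 3 j` around the average degree. -/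
noncomputable def kParam (kstar : ℝ) (G : SimpleGraph (Fin n)) : ℕ :=
  sInf {j : ℕ | 0 < j ∧ {v : Fin n | (nodeDegree G v : ℝ) ∉ degreeInterval kstar j G}.ncard ≤ j}

/-- The set that defines `k_G` is nonempty, so the minimum is attained. -/
theorem kParam_spec (kstar : ℝ) (G : SimpleGraph (Fin n)) :
    0 < kParam kstar G ∧
      {v : Fin n | (nodeDegree G v : ℝ) ∉ degreeInterval kstar (kParam kstar G) G}.ncard
        ≤ kParam kstar G := by
  have hne : {j : ℕ | 0 < j ∧
      {v : Fin n | (nodeDegree G v : ℝ) ∉ degreeInterval kstar j G}.ncard ≤ j}.Nonempty := by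
    refine ⟨n + 1, Nat.succ_pos n, ?_⟩
    refine (Set.ncard_le_ncard (Set.subset_univ _)).trans ?_
    simp [Set.ncard_univ]
  exact Nat.sInf_mem hne

/-- `t_v`: the distance between the degree of `v` and the interval of radius `k* + 3 k_G` around the
average degree. -/
noncomputable def degreeGap (kstar : ℝ) (G : SimpleGraph (Fin n)) (v : Fin n) : ℝ :=
  Metric.infDist (nodeDegree G v : ℝ) (degreeInterval kstar (kParam kstar G) G)

/-- The weight of a vertex. -/
noncomputable def vertexWeight (kstar β : ℝ) (G : SimpleGraph (Fin n)) (v : Fin n) : ℝ :=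
  max 0 (1 - β * degreeGap kstar G v)

/-- The weight of a pair of vertices. -/
noncomputable def pairWeight (kstar β : ℝ) (G : SimpleGraph (Fin n)) (u v : Fin n) : ℝ :=
  min (vertexWeight kstar β G u) (vertexWeight kstar β G v)

open Classical in
/-- The value of a pair of vertices. -/
noncomputable def pairValue (kstar β : ℝ) (G : SimpleGraph (Fin n)) (u v : Fin n) : ℝ :=
  pairWeight kstar β G u v * (if G.Adj u v then 1 else 0)
    + (1 - pairWeight kstar β G u v) * edgeDensity G

/-- The reweighted edge count `f(G)`, the sum of the values of all unordered pairs of distinct vertices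
(each such pair is listed once, with the smaller vertex first). -/
noncomputable def reweightedCount (kstar β : ℝ) (G : SimpleGraph (Fin n)) : ℝ :=
  ∑ u : Fin n, ∑ v ∈ Finset.Ioi u, pairValue kstar β G u v

end Graph

/-- The function `(x + k*) (1 + β x) + 1/β`, which up to a constant factor bounds the local sensitivity of
the reweighted edge count at graphs with `k_G = x`. -/
noncomputable def sensitivityBound (kstar β x : ℝ) : ℝ :=
  (x + kstar) * (1 + β * x) + 1 / β

/-- `c` is a constant for which `c ((k_G + k*) (1 + β k_G) + 1/β)` bounds the local sensitivity of the
reweighted edge count, uniformly in all the parameters and graphs. -/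
def IsSensitivityConstant (c : ℝ) : Prop :=
  ∀ n : ℕ, 2 ≤ n → ∀ kstar β : ℝ, 0 ≤ kstar → 0 < β → ∀ G : SimpleGraph (Fin n),
    localSensitivity (reweightedCount kstar β) G
      ≤ c * sensitivityBound kstar β (kParam kstar G : ℝ)

/-- The noise magnitude `s`, the maximum over `ℓ ≥ 0` of
`c e^{-β ℓ} ((k_G + ℓ + k*) (1 + β (k_G + ℓ)) + 1/β)`. -/
noncomputable def noiseScale {n : ℕ} (c kstar β : ℝ) (G : SimpleGraph (Fin n)) : ℝ :=
  ⨆ l : ℕ, c * Real.exp (-β * (l : ℝ)) * sensitivityBound kstar β ((kParam kstar G : ℝ) + (l : ℝ))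

/-- The parameter `β = min(ε, 1/√k*)`, with `1/√0` read as `∞`. -/
noncomputable def betaParam (ε kstar : ℝ) : ℝ :=
  if kstar = 0 then ε else min ε (1 / Real.sqrt kstar)

/-- The law of the output of the private edge-density estimator on input `G`: the estimator returns
`(f(G) + (s/ε) Z) / C(n,2)`, where `Z` has Student's t-distribution with three degrees of freedom. -/
noncomputable def edgeDensityEstimator {n : ℕ} (c ε kstar : ℝ) (G : SimpleGraph (Fin n)) : Measure ℝ :=
  studentT3.map fun z : ℝ =>
    (1 / (n.choose 2 : ℝ)) *
      (reweightedCount kstar (betaParam ε kstar) G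
        + (noiseScale c kstar (betaParam ε kstar) G / ε) * z)

/-! Privacy rests on the smooth sensitivity method, accuracy on the exactness of `f` on concentrated
graphs. The main work is the bound on the local sensitivity of `f`.

Let G and G' differ only at the vertex i, and let T consist of i and all vertices whose degree is
outside the interval of G or of G'. Rewiring i moves the deviation deg − avg of any other vertex by
at most 3, which one extra unit of k_G absorbs, so k_G changes by at most 1 and |T| ≤ 4 k_G. Off T
all weights are 1, so the density cancels there. By `two_mul_reweightedCount`, 2f is the adjacency
sum over the complement of T, which is the same for both graphs, plus one term per vertex of T built
from w_u (deg u − avg), plus one bounded term per ordered pair in T. Weights are O(β)-stable, and a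
vertex of nonzero weight has deviation at most R = O(k_G + k* + 1/β). The vertex terms thus change
by O(|T|(1 + βR) + R) and the pair terms by O(|T|²(β + 1/n) + |T|). Since |T| ≤ n, the total is
O(g(k_G)): `abs_reweightedCount_sub_le`.

Smoothness of S is a shift of ℓ by one (`noiseScale_le_exp_mul`). Between adjacent graphs the output
law changes by an affine map of Z with shift at most ε and scale in [e^{-ε}, e^ε]. The polynomial
tail of the t-density makes this cost only a factor e^{9ε} (`studentT3Density_le_affine`).

On a concentrated graph every weight is 1, so f(G) = |E| and the error is pure noise. There k_G = 1
and s = O(k* + 1/ε); the finite second moment of Z finishes the bound. -/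

/-! ### Distance to an interval and symmetric double sums. -/

/-- The distance from a real number to a symmetric interval. -/
theorem Real.infDist_Icc_sub_add {r : ℝ} (hr : 0 ≤ r) (x c : ℝ) :
    Metric.infDist x (Set.Icc (c - r) (c + r)) = max 0 (|x - c| - r) := by
  apply le_antisymm
  · have key : ∀ y ∈ Set.Icc (c - r) (c + r), |x - y| ≤ max 0 (|x - c| - r) →
        Metric.infDist x (Set.Icc (c - r) (c + r)) ≤ max 0 (|x - c| - r) := by
      intro y hy h
      exact (Metric.infDist_le_dist_of_mem hy).trans (by rwa [Real.dist_eq])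
    rcases le_total x (c - r) with h | h
    · refine key (c - r) ⟨le_rfl, by linarith⟩ (le_max_of_le_right ?_)
      rw [abs_of_nonpos (by linarith), abs_of_nonpos (by linarith)]
      linarith
    · rcases le_total x (c + r) with h' | h'
      · exact key x ⟨h, h'⟩ (le_max_of_le_left (by simp))
      · refine key (c + r) ⟨by linarith, le_rfl⟩ (le_max_of_le_right ?_)
        rw [abs_of_nonneg (by linarith), abs_of_nonneg (by linarith)]
        linarith
  · refine (Metric.le_infDist (Set.nonempty_Icc.2 (by linarith))).2 fun y hy => ?_
    rw [Real.dist_eq]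
    refine max_le (abs_nonneg _) ?_
    have h1 : |y - c| ≤ r := abs_le.2 ⟨by linarith [hy.1], by linarith [hy.2]⟩
    have h2 := abs_sub_le x y c
    linarith

theorem Finset.two_mul_sum_sum_Ioi {ι : Type*} [Fintype ι] [LinearOrder ι]
    [LocallyFiniteOrder ι] [LocallyFiniteOrderTop ι] [LocallyFiniteOrderBot ι]
    (F : ι → ι → ℝ) (hF : ∀ u v, F u v = F v u) :
    2 * ∑ u, ∑ v ∈ Finset.Ioi u, F u v = ∑ u, ∑ v, if u = v then 0 else F u v := by
  have h1 : ∑ u, ∑ v ∈ Finset.Ioi u, F u v = ∑ u, ∑ v, if u < v then F u v else 0 := by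
    refine Finset.sum_congr rfl fun u _ => ?_
    rw [← Finset.sum_filter]
    exact Finset.sum_congr (by ext; simp) fun _ _ => rfl
  have h2 : ∑ u, ∑ v, (if u < v then F u v else 0) = ∑ u, ∑ v, if v < u then F u v else 0 := by
    rw [Finset.sum_comm]
    simp only [hF]
  rw [two_mul, h1]
  nth_rewrite 2 [h2]
  rw [← Finset.sum_add_distrib]
  refine Finset.sum_congr rfl fun u _ => ?_
  rw [← Finset.sum_add_distrib]
  refine Finset.sum_congr rfl fun v _ => ?_
  rcases lt_trichotomy u v with h | h | h
  · simp [h, h.ne, h.not_gt]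
  · simp [h]
  · simp [h, h.ne', h.not_gt]

/-- A symmetric double sum weighted by minima of weights that are `1` outside `T`. -/
theorem Finset.sum_sum_min_mul {ι : Type*} [Fintype ι] [DecidableEq ι] (T : Finset ι) (w : ι → ℝ)
    (hw : ∀ u, w u ≤ 1) (hT : ∀ u, u ∉ T → w u = 1) (a : ι → ι → ℝ) (ha : ∀ u v, a u v = a v u) :
    ∑ u, ∑ v, min (w u) (w v) * a u v =
      ∑ u ∈ Tᶜ, ∑ v ∈ Tᶜ, a u v + ∑ u ∈ T, 2 * (w u * ∑ v, a u v)
        + ∑ u ∈ T, ∑ v ∈ T, (min (w u) (w v) - 2 * w u) * a u v := by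
  have hsplit : ∀ g : ι → ℝ, ∑ v, g v = ∑ v ∈ T, g v + ∑ v ∈ Tᶜ, g v := fun g =>
    (Finset.sum_add_sum_compl T g).symm
  have e1 : ∀ u ∈ T, ∑ v ∈ Tᶜ, min (w u) (w v) * a u v = w u * ∑ v ∈ Tᶜ, a u v := by
    intro u _
    rw [Finset.mul_sum]
    refine Finset.sum_congr rfl fun v hv => ?_
    rw [hT v (Finset.mem_compl.1 hv), min_eq_left (hw u)]
  have e2 : ∑ u ∈ Tᶜ, ∑ v ∈ T, min (w u) (w v) * a u v
      = ∑ u ∈ T, ∑ v ∈ Tᶜ, min (w u) (w v) * a u v := by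
    rw [Finset.sum_comm]
    refine Finset.sum_congr rfl fun u _ => Finset.sum_congr rfl fun v _ => ?_
    rw [min_comm, ha]
  have e3 : ∑ u ∈ Tᶜ, ∑ v ∈ Tᶜ, min (w u) (w v) * a u v = ∑ u ∈ Tᶜ, ∑ v ∈ Tᶜ, a u v := by
    refine Finset.sum_congr rfl fun u hu => Finset.sum_congr rfl fun v hv => ?_
    rw [hT v (Finset.mem_compl.1 hv), hT u (Finset.mem_compl.1 hu), min_self, one_mul]
  have e4 : ∑ u ∈ Tᶜ, ∑ v, min (w u) (w v) * a u v
      = ∑ u ∈ T, ∑ v ∈ Tᶜ, min (w u) (w v) * a u v + ∑ u ∈ Tᶜ, ∑ v ∈ Tᶜ, a u v := by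
    rw [← e2, ← e3, ← Finset.sum_add_distrib]
    exact Finset.sum_congr rfl fun u _ => hsplit _
  rw [hsplit, e4]
  -- By symmetry the mixed block occurs twice. Completing both copies to full rows costs a
  -- correction supported on T × T; the subtracted last sum cancels the mixed block in `e4`.
  have e5 : ∀ u ∈ T, ∑ v, min (w u) (w v) * a u v =
      2 * (w u * ∑ v, a u v) + ∑ v ∈ T, (min (w u) (w v) - 2 * w u) * a u v
        - ∑ v ∈ Tᶜ, min (w u) (w v) * a u v := by
    intro u hu
    rw [hsplit, hsplit (fun v => a u v), e1 u hu]
    simp only [sub_mul, Finset.sum_sub_distrib, mul_assoc, ← Finset.mul_sum]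
    ring
  rw [Finset.sum_congr rfl e5]
  simp only [Finset.sum_sub_distrib, Finset.sum_add_distrib]
  ring

/-! ### Degrees, densities, and the decomposition of f along a vertex set. -/

section Graph

variable {n : ℕ}

open Classical in
/-- The indicator of adjacency. -/
noncomputable def edgeIndicator (G : SimpleGraph (Fin n)) (u v : Fin n) : ℝ :=
  if G.Adj u v then 1 else 0

/-- The edge density, off the diagonal. -/
noncomputable def offDiagDensity (G : SimpleGraph (Fin n)) (u v : Fin n) : ℝ :=
  if u = v then 0 else edgeDensity G

theorem edgeIndicator_comm (G : SimpleGraph (Fin n)) (u v : Fin n) :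
    edgeIndicator G u v = edgeIndicator G v u := by
  classical
  unfold edgeIndicator
  exact if_congr (G.adj_comm u v) rfl rfl

theorem offDiagDensity_comm (G : SimpleGraph (Fin n)) (u v : Fin n) :
    offDiagDensity G u v = offDiagDensity G v u := by
  simp [offDiagDensity, eq_comm]

theorem edgeIndicator_self (G : SimpleGraph (Fin n)) (u : Fin n) : edgeIndicator G u u = 0 := by
  simp [edgeIndicator]

theorem edgeIndicator_mem_Icc (G : SimpleGraph (Fin n)) (u v : Fin n) :
    edgeIndicator G u v ∈ Set.Icc (0 : ℝ) 1 := by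
  unfold edgeIndicator; split <;> simp

theorem sum_edgeIndicator (G : SimpleGraph (Fin n)) (u : Fin n) :
    ∑ v, edgeIndicator G u v = nodeDegree G u := by
  classical
  simp only [edgeIndicator, nodeDegree]
  rw [Finset.sum_boole, Set.ncard_eq_toFinset_card']
  congr 2
  ext v
  simp

theorem sum_nodeDegree (G : SimpleGraph (Fin n)) :
    ∑ v, (nodeDegree G v : ℝ) = 2 * edgeCount G := by
  classical
  have h := G.sum_degrees_eq_twice_card_edges
  have h1 : ∀ v, nodeDegree G v = G.degree v := fun v => by
    rw [nodeDegree, Set.ncard_eq_toFinset_card']; rfl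
  have h2 : edgeCount G = G.edgeFinset.card := by
    rw [edgeCount, Set.ncard_eq_toFinset_card']; rfl
  simp only [h1, h2]
  exact_mod_cast h

theorem avgDegree_eq (hn : 2 ≤ n) (G : SimpleGraph (Fin n)) :
    avgDegree G = 2 * (edgeCount G : ℝ) / n := by
  have h : (2 : ℝ) ≤ n := by exact_mod_cast hn
  have h1 : (n : ℝ) - 1 ≠ 0 := by linarith
  have h2 : (n : ℝ) ≠ 0 := by linarith
  rw [avgDegree, edgeDensity, Nat.cast_choose_two]
  field_simp

theorem edgeDensity_eq (hn : 2 ≤ n) (G : SimpleGraph (Fin n)) :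
    edgeDensity G = avgDegree G / ((n : ℝ) - 1) := by
  have h : (2 : ℝ) ≤ n := by exact_mod_cast hn
  have h1 : (n : ℝ) - 1 ≠ 0 := by linarith
  rw [avgDegree]
  field_simp

/-- The zero diagonal leaves n − 1 copies of the density, so a full row of indicator minus density
sums exactly to deg u − avg. -/
theorem sum_offDiagDensity (G : SimpleGraph (Fin n)) (u : Fin n) :
    ∑ v, offDiagDensity G u v = avgDegree G := by
  have h : ∀ v, offDiagDensity G u v = edgeDensity G - if u = v then edgeDensity G else 0 := by
    intro v; unfold offDiagDensity; split <;> simp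
  simp only [h, Finset.sum_sub_distrib, Finset.sum_ite_eq, Finset.mem_univ, if_true]
  simp [avgDegree]
  ring

theorem nodeDegree_le (G : SimpleGraph (Fin n)) (u : Fin n) : (nodeDegree G u : ℝ) ≤ n - 1 := by
  have h : ∑ v, edgeIndicator G u v ≤ ∑ v, ((1 : ℝ) - if u = v then 1 else 0) := by
    refine Finset.sum_le_sum fun v _ => ?_
    rcases eq_or_ne u v with rfl | h
    · simp [edgeIndicator_self]
    · simpa [h] using (edgeIndicator_mem_Icc G u v).2
  rw [sum_edgeIndicator, Finset.sum_sub_distrib] at h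
  simpa using h

theorem edgeDensity_mem_Icc (hn : 2 ≤ n) (G : SimpleGraph (Fin n)) :
    edgeDensity G ∈ Set.Icc (0 : ℝ) 1 := by
  have h : (2 : ℝ) ≤ n := by exact_mod_cast hn
  have hs : ∑ v, (nodeDegree G v : ℝ) ≤ ∑ _v : Fin n, ((n : ℝ) - 1) :=
    Finset.sum_le_sum fun v _ => nodeDegree_le G v
  rw [sum_nodeDegree] at hs
  simp only [Finset.sum_const, Finset.card_univ, Fintype.card_fin, nsmul_eq_mul] at hs
  rw [edgeDensity]
  refine ⟨by positivity, div_le_one_of_le₀ ?_ (by positivity)⟩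
  rw [Nat.cast_choose_two]
  linarith

theorem offDiagDensity_mem_Icc (hn : 2 ≤ n) (G : SimpleGraph (Fin n)) (u v : Fin n) :
    offDiagDensity G u v ∈ Set.Icc (0 : ℝ) 1 := by
  unfold offDiagDensity
  split
  · simp
  · exact edgeDensity_mem_Icc hn G

theorem degreeGap_eq {kstar : ℝ} (hk : 0 ≤ kstar) (G : SimpleGraph (Fin n)) (v : Fin n) :
    degreeGap kstar G v =
      max 0 (|(nodeDegree G v : ℝ) - avgDegree G| - (kstar + 3 * (kParam kstar G : ℝ))) := by
  rw [degreeGap, degreeInterval, Real.infDist_Icc_sub_add (by positivity)]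

theorem vertexWeight_mem_Icc {kstar β : ℝ} (hβ : 0 < β) (G : SimpleGraph (Fin n)) (v : Fin n) :
    vertexWeight kstar β G v ∈ Set.Icc (0 : ℝ) 1 := by
  have h : 0 ≤ degreeGap kstar G v := Metric.infDist_nonneg
  exact ⟨le_max_left _ _, max_le zero_le_one (by nlinarith)⟩

theorem vertexWeight_eq_one {kstar β : ℝ} {G : SimpleGraph (Fin n)} {v : Fin n}
    (h : (nodeDegree G v : ℝ) ∈ degreeInterval kstar (kParam kstar G) G) :
    vertexWeight kstar β G v = 1 := by
  rw [vertexWeight, degreeGap, Metric.infDist_zero_of_mem h]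
  simp

/-- The contribution of a pair of vertices inside the exceptional set. -/
noncomputable def pairResidue (kstar β : ℝ) (G : SimpleGraph (Fin n)) (u v : Fin n) : ℝ :=
  (pairWeight kstar β G u v - 2 * vertexWeight kstar β G u)
    * (edgeIndicator G u v - offDiagDensity G u v) - offDiagDensity G u v

/-- Twice the reweighted edge count, with the pairs inside `T` separated from the others. -/
theorem two_mul_reweightedCount {kstar β : ℝ} (hβ : 0 < β) (G : SimpleGraph (Fin n))
    (T : Finset (Fin n))
    (hT : ∀ v, v ∉ T → (nodeDegree G v : ℝ) ∈ degreeInterval kstar (kParam kstar G) G) :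
    2 * reweightedCount kstar β G =
      ∑ u ∈ Tᶜ, ∑ v ∈ Tᶜ, edgeIndicator G u v
      + ∑ u ∈ T, (2 * avgDegree G
          + 2 * (vertexWeight kstar β G u * ((nodeDegree G u : ℝ) - avgDegree G)))
      + ∑ u ∈ T, ∑ v ∈ T, pairResidue kstar β G u v := by
  have hsymm : ∀ u v, pairValue kstar β G u v = pairValue kstar β G v u := by
    intro u v
    have h := edgeIndicator_comm G u v
    unfold edgeIndicator at h
    rw [pairValue, pairValue, h, pairWeight, pairWeight, min_comm]
  rw [reweightedCount, Finset.two_mul_sum_sum_Ioi _ hsymm]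
  -- The density gets the artificial weight `min 1 1` so that `Finset.sum_sum_min_mul` applies to
  -- both summands; the two density sums over the complement of T then cancel.
  have hval : ∀ u v, (if u = v then 0 else pairValue kstar β G u v) =
      min (vertexWeight kstar β G u) (vertexWeight kstar β G v)
          * (edgeIndicator G u v - offDiagDensity G u v)
        + min 1 1 * offDiagDensity G u v := by
    intro u v
    rcases eq_or_ne u v with rfl | h
    · simp [edgeIndicator_self, offDiagDensity]
    · simp only [h, if_false, pairValue, pairWeight, edgeIndicator, offDiagDensity]
      rw [min_self]
      ring
  simp only [hval, Finset.sum_add_distrib]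
  rw [Finset.sum_sum_min_mul T (vertexWeight kstar β G)
      (fun u => (vertexWeight_mem_Icc hβ G u).2) (fun u hu => vertexWeight_eq_one (hT u hu))
      (fun u v => edgeIndicator G u v - offDiagDensity G u v)
      (fun u v => by rw [edgeIndicator_comm, offDiagDensity_comm]),
    Finset.sum_sum_min_mul T (fun _ => (1 : ℝ)) (fun _ => le_rfl) (fun _ _ => rfl)
      (offDiagDensity G) (offDiagDensity_comm G)]
  simp only [Finset.sum_sub_distrib, sum_edgeIndicator, sum_offDiagDensity, pairResidue, pairWeight, min_self,
    ← Finset.mul_sum]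
  norm_num
  ring

/-- A graph all of whose degrees are in the interval has its exact edge count returned. -/
theorem reweightedCount_eq_edgeCount {kstar β : ℝ} (hβ : 0 < β)
    (G : SimpleGraph (Fin n))
    (h : ∀ v, (nodeDegree G v : ℝ) ∈ degreeInterval kstar (kParam kstar G) G) :
    reweightedCount kstar β G = edgeCount G := by
  have h1 := two_mul_reweightedCount hβ G ∅ (fun v _ => h v)
  simp only [Finset.compl_empty, Finset.sum_empty, sum_edgeIndicator, sum_nodeDegree] at h1
  linarith

end Graph

/-! ### Effect of rewiring a single vertex i. -/

section Adjacent

variable {n : ℕ}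

theorem NodeAdjacent.symm {G G' : SimpleGraph (Fin n)} (h : NodeAdjacent G G') :
    NodeAdjacent G' G := by
  obtain ⟨i, hi⟩ := h
  exact ⟨i, fun u v hu hv => (hi u v hu hv).symm⟩

variable {G G' : SimpleGraph (Fin n)} {i : Fin n}

theorem edgeIndicator_eq_of_adjacent
    (hi : ∀ u v : Fin n, u ≠ i → v ≠ i → (G.Adj u v ↔ G'.Adj u v)) {u v : Fin n}
    (hu : u ≠ i) (hv : v ≠ i) : edgeIndicator G u v = edgeIndicator G' u v := by
  classical
  unfold edgeIndicator
  exact if_congr (hi u v hu hv) rfl rfl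

theorem abs_edgeIndicator_sub_le (G G' : SimpleGraph (Fin n)) (u v : Fin n) :
    |edgeIndicator G u v - edgeIndicator G' u v| ≤ 1 := by
  have h := edgeIndicator_mem_Icc G u v
  have h' := edgeIndicator_mem_Icc G' u v
  exact abs_le.2 ⟨by linarith [h.1, h'.2], by linarith [h.2, h'.1]⟩

theorem abs_nodeDegree_sub_le
    (hi : ∀ u v : Fin n, u ≠ i → v ≠ i → (G.Adj u v ↔ G'.Adj u v)) {u : Fin n} (hu : u ≠ i) :
    |(nodeDegree G u : ℝ) - nodeDegree G' u| ≤ 1 := by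
  rw [← sum_edgeIndicator, ← sum_edgeIndicator, ← Finset.sum_sub_distrib,
    Finset.sum_eq_single i]
  · exact abs_edgeIndicator_sub_le G G' u i
  · intro v _ hv
    rw [edgeIndicator_eq_of_adjacent hi hu hv, sub_self]
  · simp

theorem abs_avgDegree_sub_le (hn : 2 ≤ n)
    (hi : ∀ u v : Fin n, u ≠ i → v ≠ i → (G.Adj u v ↔ G'.Adj u v)) :
    |avgDegree G - avgDegree G'| ≤ 2 := by
  have h2 : (2 : ℝ) ≤ n := by exact_mod_cast hn
  -- Summed over u this gives 2n, hence a change of at most 2 in the average.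
  have hdeg : ∀ u, |(nodeDegree G u : ℝ) - nodeDegree G' u| ≤ 1 + if u = i then (n : ℝ) else 0 := by
    intro u
    split
    · have h := nodeDegree_le G u
      have h' := nodeDegree_le G' u
      have h0 : (0 : ℝ) ≤ nodeDegree G u := Nat.cast_nonneg _
      have h0' : (0 : ℝ) ≤ nodeDegree G' u := Nat.cast_nonneg _
      exact abs_le.2 ⟨by linarith, by linarith⟩
    · simpa using abs_nodeDegree_sub_le hi ‹_›
  have hs := (Finset.abs_sum_le_sum_abs (fun u => (nodeDegree G u : ℝ) - nodeDegree G' u)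
    Finset.univ).trans (Finset.sum_le_sum fun u _ => hdeg u)
  simp only [Finset.sum_add_distrib, Finset.sum_sub_distrib, sum_nodeDegree, Finset.sum_const,
    Finset.card_univ, Fintype.card_fin, nsmul_eq_mul, Finset.sum_ite_eq', Finset.mem_univ,
    if_true] at hs
  rw [avgDegree_eq hn, avgDegree_eq hn, ← sub_div, abs_div, Nat.abs_cast,
    div_le_iff₀ (by linarith)]
  linarith

theorem abs_edgeDensity_sub_le (hn : 2 ≤ n)
    (hi : ∀ u v : Fin n, u ≠ i → v ≠ i → (G.Adj u v ↔ G'.Adj u v)) :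
    |edgeDensity G - edgeDensity G'| ≤ 4 / n := by
  have h2 : (2 : ℝ) ≤ n := by exact_mod_cast hn
  have h := abs_avgDegree_sub_le hn hi
  rw [edgeDensity_eq hn, edgeDensity_eq hn, ← sub_div, abs_div, abs_of_pos (by linarith : (0 : ℝ) < n - 1)]
  rw [div_le_div_iff₀ (by linarith) (by linarith)]
  nlinarith

theorem abs_offDiagDensity_sub_le (hn : 2 ≤ n)
    (hi : ∀ u v : Fin n, u ≠ i → v ≠ i → (G.Adj u v ↔ G'.Adj u v)) (u v : Fin n) :
    |offDiagDensity G u v - offDiagDensity G' u v| ≤ 4 / n := by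
  unfold offDiagDensity
  split
  · simp; positivity
  · exact abs_edgeDensity_sub_le hn hi

theorem abs_deviation_sub_le (hn : 2 ≤ n)
    (hi : ∀ u v : Fin n, u ≠ i → v ≠ i → (G.Adj u v ↔ G'.Adj u v)) {u : Fin n} (hu : u ≠ i) :
    |((nodeDegree G u : ℝ) - avgDegree G) - ((nodeDegree G' u : ℝ) - avgDegree G')| ≤ 3 := by
  have h1 := abs_le.1 (abs_nodeDegree_sub_le hi hu)
  have h2 := abs_le.1 (abs_avgDegree_sub_le hn hi)
  exact abs_le.2 ⟨by linarith [h1.1, h2.2], by linarith [h1.2, h2.1]⟩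

theorem mem_degreeInterval_iff {kstar : ℝ} {j : ℕ} {G : SimpleGraph (Fin n)} {x : ℝ} :
    x ∈ degreeInterval kstar j G ↔ |x - avgDegree G| ≤ kstar + 3 * (j : ℝ) := by
  rw [degreeInterval, Set.mem_Icc, abs_le]
  constructor <;> rintro ⟨h, h'⟩ <;> constructor <;> linarith

/-- The parameter `k_G` changes by at most one between node-adjacent graphs. -/
theorem kParam_le_succ (hn : 2 ≤ n) (kstar : ℝ) (h : NodeAdjacent G G') :
    kParam kstar G' ≤ kParam kstar G + 1 := by
  obtain ⟨i, hi⟩ := h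
  -- Raising j by one widens the radius by 3, exactly the possible drift of a deviation (1 from the
  -- degree, 2 from the average). Only i can become a new exception, and the extra unit of j allows
  -- for it.
  refine Nat.sInf_le ⟨Nat.succ_pos _, ?_⟩
  refine (Set.ncard_le_ncard (t := insert i {v : Fin n | (nodeDegree G v : ℝ) ∉
    degreeInterval kstar (kParam kstar G) G}) ?_ (Set.toFinite _)).trans
    ((Set.ncard_insert_le _ _).trans (Nat.succ_le_succ (kParam_spec kstar G).2))
  intro v hv
  by_contra hcon
  simp only [Set.mem_insert_iff, Set.mem_ofPred_eq, not_or, not_not] at hcon hv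
  refine hv (mem_degreeInterval_iff.2 ?_)
  have h1 := mem_degreeInterval_iff.1 hcon.2
  have h2 := abs_deviation_sub_le hn hi hcon.1
  rw [abs_le] at *
  push_cast
  constructor <;> linarith [h1.1, h1.2, h2.1, h2.2]

/-- The 6 is 3 for the drift of the deviation plus 3 for the change of radius when k_G moves by one.
-/
theorem degreeGap_le_add (hn : 2 ≤ n) {kstar : ℝ} (hk : 0 ≤ kstar)
    (hi : ∀ u v : Fin n, u ≠ i → v ≠ i → (G.Adj u v ↔ G'.Adj u v)) {u : Fin n} (hu : u ≠ i) :
    degreeGap kstar G u ≤ degreeGap kstar G' u + 6 := by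
  have hkp : (kParam kstar G' : ℝ) ≤ kParam kstar G + 1 := by
    exact_mod_cast kParam_le_succ hn kstar ⟨i, hi⟩
  have h1 := abs_deviation_sub_le hn hi hu
  have h2 := abs_sub_abs_le_abs_sub ((nodeDegree G u : ℝ) - avgDegree G)
    ((nodeDegree G' u : ℝ) - avgDegree G')
  rw [degreeGap_eq hk, degreeGap_eq hk]
  refine max_le (by positivity) ?_
  have h3 := le_max_right 0
    (|(nodeDegree G' u : ℝ) - avgDegree G'| - (kstar + 3 * (kParam kstar G' : ℝ)))
  linarith

theorem abs_vertexWeight_sub_le (hn : 2 ≤ n) {kstar β : ℝ} (hk : 0 ≤ kstar) (hβ : 0 < β)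
    (hi : ∀ u v : Fin n, u ≠ i → v ≠ i → (G.Adj u v ↔ G'.Adj u v)) {u : Fin n} (hu : u ≠ i) :
    |vertexWeight kstar β G u - vertexWeight kstar β G' u| ≤ 6 * β := by
  have h1 := degreeGap_le_add hn hk hi hu
  have h2 := degreeGap_le_add hn hk (fun u v hu hv => (hi u v hu hv).symm) hu
  refine (abs_max_sub_max_le_max _ _ _ _).trans (max_le (by simp; positivity) ?_)
  rw [abs_le]
  constructor <;> nlinarith

/-- A vertex of positive weight has degree close to the average. -/
theorem abs_deviation_le_of_vertexWeight_ne_zero {kstar β : ℝ} (hk : 0 ≤ kstar) (hβ : 0 < β)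
    {u : Fin n} (hw : vertexWeight kstar β G u ≠ 0) :
    |(nodeDegree G u : ℝ) - avgDegree G| ≤ kstar + 3 * (kParam kstar G : ℝ) + 1 / β := by
  have h1 : degreeGap kstar G u < 1 / β := by
    by_contra hcon
    rw [not_lt, div_le_iff₀' hβ] at hcon
    exact hw (max_eq_left (by linarith))
  rw [degreeGap_eq hk] at h1
  linarith [le_max_right 0 (|(nodeDegree G u : ℝ) - avgDegree G| - (kstar + 3 * (kParam kstar G : ℝ)))]

theorem abs_vertexWeight_mul_deviation_le {kstar β : ℝ} (hk : 0 ≤ kstar) (hβ : 0 < β)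
    (G : SimpleGraph (Fin n)) (u : Fin n) :
    |vertexWeight kstar β G u * ((nodeDegree G u : ℝ) - avgDegree G)|
      ≤ kstar + 3 * (kParam kstar G : ℝ) + 1 / β := by
  by_cases hw : vertexWeight kstar β G u = 0
  · rw [hw, zero_mul, abs_zero]
    positivity
  · have hw' := vertexWeight_mem_Icc (kstar := kstar) hβ G u
    rw [abs_mul, abs_of_nonneg hw'.1]
    exact (mul_le_of_le_one_left (abs_nonneg _) hw'.2).trans
      (abs_deviation_le_of_vertexWeight_ne_zero hk hβ hw)

/-- A deviation can be as large as n, so the product rule must multiply the weight difference by the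
deviation in a graph where the weight is nonzero. If both weights vanish there is nothing to bound.
-/
theorem abs_vertexWeight_mul_deviation_sub_le (hn : 2 ≤ n) {kstar β : ℝ} (hk : 0 ≤ kstar)
    (hβ : 0 < β) (hi : ∀ u v : Fin n, u ≠ i → v ≠ i → (G.Adj u v ↔ G'.Adj u v)) {u : Fin n}
    (hu : u ≠ i) :
    |vertexWeight kstar β G u * ((nodeDegree G u : ℝ) - avgDegree G)
      - vertexWeight kstar β G' u * ((nodeDegree G' u : ℝ) - avgDegree G')|
      ≤ 6 * β * (kstar + 3 * (kParam kstar G : ℝ) + 3 + 1 / β) + 3 := by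
  have hW := abs_vertexWeight_sub_le hn hk hβ hi hu
  have hD := abs_deviation_sub_le hn hi hu
  have hw := vertexWeight_mem_Icc (kstar := kstar) hβ G u
  have hw' := vertexWeight_mem_Icc (kstar := kstar) hβ G' u
  have hkp : (kParam kstar G' : ℝ) ≤ kParam kstar G + 1 := by
    exact_mod_cast kParam_le_succ hn kstar ⟨i, hi⟩
  have hN := abs_deviation_le_of_vertexWeight_ne_zero (G := G) (u := u) hk hβ
  have hN' := abs_deviation_le_of_vertexWeight_ne_zero (G := G') (u := u) hk hβ
  set w := vertexWeight kstar β G u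
  set w' := vertexWeight kstar β G' u
  set D := (nodeDegree G u : ℝ) - avgDegree G
  set D' := (nodeDegree G' u : ℝ) - avgDegree G'
  have hR : 0 ≤ kstar + 3 * (kParam kstar G : ℝ) + 3 + 1 / β := by positivity
  by_cases h0 : w = 0
  · by_cases h0' : w' = 0
    · rw [h0, h0']
      simp
      positivity
    · have e : w * D - w' * D' = (w - w') * D' + w * (D - D') := by ring
      rw [e]
      refine (abs_add_le _ _).trans (add_le_add ?_ ?_)
      · rw [abs_mul]
        exact mul_le_mul hW (by linarith [hN' h0']) (abs_nonneg _) (by positivity)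
      · rw [h0]; simp
  · have e : w * D - w' * D' = (w - w') * D + w' * (D - D') := by ring
    rw [e]
    refine (abs_add_le _ _).trans (add_le_add ?_ ?_)
    · rw [abs_mul]
      exact mul_le_mul hW (by linarith [hN h0]) (abs_nonneg _) (by positivity)
    · rw [abs_mul, abs_of_nonneg hw'.1]
      exact (mul_le_of_le_one_left (abs_nonneg _) hw'.2).trans hD

theorem abs_pairWeight_sub_two_mul_le {kstar β : ℝ} (hβ : 0 < β) (G : SimpleGraph (Fin n))
    (u v : Fin n) : |pairWeight kstar β G u v - 2 * vertexWeight kstar β G u| ≤ 2 := by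
  have hu := vertexWeight_mem_Icc (kstar := kstar) hβ G u
  have hv := vertexWeight_mem_Icc (kstar := kstar) hβ G v
  have h1 : pairWeight kstar β G u v ≤ vertexWeight kstar β G u := min_le_left _ _
  have h2 : 0 ≤ pairWeight kstar β G u v := le_min hu.1 hv.1
  exact abs_le.2 ⟨by linarith [hu.2], by linarith [hu.1]⟩

theorem abs_edgeIndicator_sub_offDiagDensity_le (hn : 2 ≤ n) (G : SimpleGraph (Fin n))
    (u v : Fin n) : |edgeIndicator G u v - offDiagDensity G u v| ≤ 1 := by
  have h := edgeIndicator_mem_Icc G u v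
  have h' := offDiagDensity_mem_Icc hn G u v
  exact abs_le.2 ⟨by linarith [h.1, h'.2], by linarith [h.2, h'.1]⟩

theorem abs_pairResidue_le (hn : 2 ≤ n) {kstar β : ℝ} (hβ : 0 < β) (G : SimpleGraph (Fin n))
    (u v : Fin n) : |pairResidue kstar β G u v| ≤ 3 := by
  have h1 := abs_pairWeight_sub_two_mul_le (kstar := kstar) hβ G u v
  have h2 := abs_edgeIndicator_sub_offDiagDensity_le hn G u v
  have h3 := offDiagDensity_mem_Icc hn G u v
  refine (abs_sub _ _).trans ?_
  rw [abs_mul, abs_of_nonneg h3.1]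
  nlinarith [h3.2, abs_nonneg (pairWeight kstar β G u v - 2 * vertexWeight kstar β G u)]

/-- The indicators agree away from i, so only weights and density move: 18β = 6β + 2·6β comes from
the weights, and 12/n = 2·(4/n) + 4/n from the density. -/
theorem abs_pairResidue_sub_le (hn : 2 ≤ n) {kstar β : ℝ} (hk : 0 ≤ kstar) (hβ : 0 < β)
    (hi : ∀ u v : Fin n, u ≠ i → v ≠ i → (G.Adj u v ↔ G'.Adj u v)) {u v : Fin n}
    (hu : u ≠ i) (hv : v ≠ i) :
    |pairResidue kstar β G u v - pairResidue kstar β G' u v| ≤ 18 * β + 12 / n := by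
  have hq := abs_offDiagDensity_sub_le hn hi u v
  have hx := edgeIndicator_eq_of_adjacent hi hu hv
  have hwu := abs_vertexWeight_sub_le hn hk hβ hi hu
  have hwv := abs_vertexWeight_sub_le hn hk hβ hi hv
  have hmin : |pairWeight kstar β G u v - pairWeight kstar β G' u v| ≤ 6 * β :=
    (abs_min_sub_min_le_max _ _ _ _).trans (max_le hwu hwv)
  have hc := abs_pairWeight_sub_two_mul_le (kstar := kstar) hβ G' u v
  have ha := abs_edgeIndicator_sub_offDiagDensity_le hn G u v
  have e : pairResidue kstar β G u v - pairResidue kstar β G' u v =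
      ((pairWeight kstar β G u v - pairWeight kstar β G' u v)
        - 2 * (vertexWeight kstar β G u - vertexWeight kstar β G' u))
          * (edgeIndicator G u v - offDiagDensity G u v)
      - (pairWeight kstar β G' u v - 2 * vertexWeight kstar β G' u)
          * (offDiagDensity G u v - offDiagDensity G' u v)
      - (offDiagDensity G u v - offDiagDensity G' u v) := by
    rw [pairResidue, pairResidue, ← hx]
    ring
  have h1 : |(pairWeight kstar β G u v - pairWeight kstar β G' u v)
        - 2 * (vertexWeight kstar β G u - vertexWeight kstar β G' u)| ≤ 18 * β := by
    refine (abs_sub _ _).trans ?_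
    rw [abs_mul, abs_two]
    linarith
  rw [e]
  refine (abs_sub _ _).trans ((add_le_add_left (abs_sub _ _) _).trans ?_)
  rw [abs_mul, abs_mul]
  have h2 := mul_le_mul h1 ha (abs_nonneg _) (by positivity)
  have h3 := mul_le_mul hc hq (abs_nonneg _) (by positivity)
  calc _ ≤ 18 * β * 1 + 2 * (4 / (n : ℝ)) + 4 / n := by linarith
    _ = _ := by ring

end Adjacent

/-! ### The local sensitivity bound. -/

section LocalSensitivity

variable {n : ℕ} {G G' : SimpleGraph (Fin n)}

theorem one_le_kParam (kstar : ℝ) (G : SimpleGraph (Fin n)) : (1 : ℝ) ≤ kParam kstar G := by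
  exact_mod_cast (kParam_spec kstar G).1

theorem Finset.abs_sum_sub_sum_le {ι : Type*} (T : Finset ι) (f g : ι → ℝ) (b : ι → ℝ)
    (h : ∀ u ∈ T, |f u - g u| ≤ b u) : |∑ u ∈ T, f u - ∑ u ∈ T, g u| ≤ ∑ u ∈ T, b u := by
  rw [← Finset.sum_sub_distrib]
  exact (Finset.abs_sum_le_sum_abs _ _).trans (Finset.sum_le_sum h)

/-- The change of the reweighted edge count between node-adjacent graphs. -/
theorem abs_reweightedCount_sub_le (hn : 2 ≤ n) {kstar β : ℝ} (hk : 0 ≤ kstar) (hβ : 0 < β)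
    (h : NodeAdjacent G G') :
    |reweightedCount kstar β G - reweightedCount kstar β G'|
      ≤ 400 * sensitivityBound kstar β (kParam kstar G : ℝ) := by
  classical
  have hkp : (kParam kstar G' : ℝ) ≤ kParam kstar G + 1 := by
    exact_mod_cast kParam_le_succ hn kstar h
  obtain ⟨i, hi⟩ := h
  set K : ℝ := (kParam kstar G : ℝ) with hK
  have hK1 : 1 ≤ K := one_le_kParam kstar G
  set B := fun H : SimpleGraph (Fin n) =>
    {v : Fin n | (nodeDegree H v : ℝ) ∉ degreeInterval kstar (kParam kstar H) H} with hB
  set T : Finset (Fin n) := insert i ((B G).toFinset ∪ (B G').toFinset) with hT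
  have hiT : i ∈ T := Finset.mem_insert_self _ _
  have hTG : ∀ v, v ∉ T → (nodeDegree G v : ℝ) ∈ degreeInterval kstar (kParam kstar G) G := by
    intro v hv
    by_contra hcon
    exact hv (Finset.mem_insert_of_mem (Finset.mem_union_left _ (Set.mem_toFinset.2 hcon)))
  have hTG' : ∀ v, v ∉ T → (nodeDegree G' v : ℝ) ∈ degreeInterval kstar (kParam kstar G') G' := by
    intro v hv
    by_contra hcon
    exact hv (Finset.mem_insert_of_mem (Finset.mem_union_right _ (Set.mem_toFinset.2 hcon)))
  set t : ℝ := (T.card : ℝ) with ht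
  have ht4 : t ≤ 4 * K := by
    -- This is at most 2K + 2, and K ≥ 1 turns it into 4K.
    have h1 : T.card ≤ kParam kstar G + kParam kstar G' + 1 := by
      refine (Finset.card_insert_le _ _).trans (Nat.succ_le_succ ?_)
      refine (Finset.card_union_le _ _).trans (Nat.add_le_add ?_ ?_)
      · rw [← Set.ncard_eq_toFinset_card']; exact (kParam_spec kstar G).2
      · rw [← Set.ncard_eq_toFinset_card']; exact (kParam_spec kstar G').2
    have h2 : t ≤ K + kParam kstar G' + 1 := by rw [ht, hK]; exact_mod_cast h1
    linarith
  have ht0 : 0 ≤ t := Nat.cast_nonneg _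
  have htn : t / n ≤ 1 := by
    refine div_le_one_of_le₀ ?_ (Nat.cast_nonneg _)
    have := T.card_le_univ
    rw [Fintype.card_fin] at this
    rw [ht]
    exact_mod_cast this
  have hcompl : ∑ u ∈ Tᶜ, ∑ v ∈ Tᶜ, edgeIndicator G u v = ∑ u ∈ Tᶜ, ∑ v ∈ Tᶜ, edgeIndicator G' u v :=
    Finset.sum_congr rfl fun u hu => Finset.sum_congr rfl fun v hv =>
      edgeIndicator_eq_of_adjacent hi
        (fun e => Finset.mem_compl.1 hu (e ▸ hiT)) (fun e => Finset.mem_compl.1 hv (e ▸ hiT))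
  set R : ℝ := kstar + 3 * K + 3 + 1 / β with hR
  have hR0 : 0 ≤ R := by positivity
  have hvertex := Finset.abs_sum_sub_sum_le T
    (fun u => 2 * avgDegree G
      + 2 * (vertexWeight kstar β G u * ((nodeDegree G u : ℝ) - avgDegree G)))
    (fun u => 2 * avgDegree G'
      + 2 * (vertexWeight kstar β G' u * ((nodeDegree G' u : ℝ) - avgDegree G')))
    -- For u ≠ i: 2·2 from the average and 2·(6βR + 3) from the weighted deviation. At i no
    -- stability is available, so the two weighted deviations are bounded separately, each by R.
    (fun u => (10 + 12 * β * R) + if u = i then 4 * R else 0) (by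
      intro u _
      have hd := abs_le.1 (abs_avgDegree_sub_le hn hi)
      rcases eq_or_ne u i with rfl | hu
      · have h1 := abs_le.1 (abs_vertexWeight_mul_deviation_le hk hβ G u)
        have h2 := abs_le.1 (abs_vertexWeight_mul_deviation_le hk hβ G' u)
        have h3 : 0 ≤ β * R := by positivity
        simp only [if_true]
        exact abs_le.2 ⟨by linarith [h1.1, h2.2, hd.1], by linarith [h1.2, h2.1, hd.2]⟩
      · have h1 := abs_le.1 (abs_vertexWeight_mul_deviation_sub_le hn hk hβ hi hu)
        simp only [hu, if_false]
        exact abs_le.2 ⟨by linarith [h1.1, hd.1], by linarith [h1.2, hd.2]⟩)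
  have hpair := Finset.abs_sum_sub_sum_le T
    (fun u => ∑ v ∈ T, pairResidue kstar β G u v) (fun u => ∑ v ∈ T, pairResidue kstar β G' u v)
    -- Pairs meeting i use only the size bound, 3 + 3 = 6; there are O(|T|) of them.
    (fun u => ∑ v ∈ T, ((18 * β + 12 / n) + (if u = i then 6 else 0) + if v = i then 6 else 0))
    (by
      refine fun u _ => Finset.abs_sum_sub_sum_le T _ _ _ fun v _ => ?_
      have hpos : (0 : ℝ) ≤ 18 * β + 12 / n := by positivity
      by_cases huv : u ≠ i ∧ v ≠ i
      · simpa [huv.1, huv.2] using abs_pairResidue_sub_le hn hk hβ hi huv.1 huv.2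
      · have h1 := abs_le.1 (abs_pairResidue_le hn (kstar := kstar) hβ G u v)
        have h2 := abs_le.1 (abs_pairResidue_le hn (kstar := kstar) hβ G' u v)
        have h3 : (6 : ℝ) ≤ (if u = i then 6 else 0) + if v = i then 6 else 0 := by
          rw [not_and_or, not_not, not_not] at huv
          rcases huv with h | h
          · rw [if_pos h]; split <;> norm_num
          · rw [if_pos h]; split <;> norm_num
        exact abs_le.2 ⟨by linarith [h1.1, h2.2], by linarith [h1.2, h2.1]⟩)
  simp only [Finset.sum_add_distrib, Finset.sum_const, nsmul_eq_mul, Finset.sum_ite_eq', hiT,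
    if_true, ← Finset.mul_sum, ← ht] at hvertex hpair
  have e := two_mul_reweightedCount hβ G T hTG
  have e' := two_mul_reweightedCount hβ G' T hTG'
  rw [← hcompl] at e'
  have hdiff : 2 * |reweightedCount kstar β G - reweightedCount kstar β G'| ≤
      (t * (10 + 12 * β * R) + 4 * R) + (t * (t * (18 * β + 12 / n)) + t * 6 + t * 6) := by
    have e2 : 2 * |reweightedCount kstar β G - reweightedCount kstar β G'|
        = |2 * reweightedCount kstar β G - 2 * reweightedCount kstar β G'| := by
      rw [← mul_sub, abs_mul, abs_two]
    rw [e2, e, e']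
    simp only [Finset.sum_add_distrib, Finset.sum_const, nsmul_eq_mul, ← Finset.mul_sum, ← ht]
    have h1 := abs_le.1 hvertex
    have h2 := abs_le.1 hpair
    exact abs_le.2 ⟨by linarith [h1.1, h2.1], by linarith [h1.2, h2.2]⟩
  have hR6 : R ≤ 6 * (K + kstar) + 1 / β := by linarith
  have hβR : β * R ≤ 6 * (β * (K + kstar)) + 1 := by
    calc β * R ≤ β * (6 * (K + kstar) + 1 / β) := mul_le_mul_of_nonneg_left hR6 hβ.le
      _ = _ := by field_simp
  have h1 : t * (β * R) ≤ 4 * K * (6 * (β * (K + kstar)) + 1) :=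
    mul_le_mul ht4 hβR (by positivity) (by positivity)
  have h2 : t * t * β ≤ 4 * K * (4 * K) * β := by gcongr
  -- The drift of the density, of order 1/n on |T|² pairs, is only linear in |T| because |T| ≤ n.
  have h3 : t * (t / n) ≤ t * 1 := mul_le_mul_of_nonneg_left htn ht0
  have h4 : 0 ≤ β * K * kstar := by positivity
  have h5 : 0 ≤ β * K * K := by positivity
  have h6 : 0 ≤ 1 / β := by positivity
  have e1 : t * (10 + 12 * β * R) + 4 * R + (t * (t * (18 * β + 12 / n)) + t * 6 + t * 6)
      = 22 * t + 12 * (t * (β * R)) + 4 * R + 18 * (t * t * β) + 12 * (t * (t / n)) := by ring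
  rw [e1] at hdiff
  have e2 : sensitivityBound kstar β K = K + kstar + β * K * K + β * K * kstar + 1 / β := by
    rw [sensitivityBound]; ring
  rw [e2]
  have e3 : 4 * K * (6 * (β * (K + kstar)) + 1)
      = 24 * (β * K * K) + 24 * (β * K * kstar) + 4 * K := by ring
  have e4 : 4 * K * (4 * K) * β = 16 * (β * K * K) := by ring
  linarith

theorem isSensitivityConstant_four_hundred : IsSensitivityConstant 400 := by
  intro n hn kstar β hk hβ G
  have : Nonempty {G' : SimpleGraph (Fin n) // NodeAdjacent G G'} :=
    ⟨G, ⟨0, by omega⟩, fun _ _ _ _ => Iff.rfl⟩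
  exact ciSup_le fun G' => abs_reweightedCount_sub_le hn hk hβ G'.2

theorem abs_sub_le_localSensitivity (f : SimpleGraph (Fin n) → ℝ) (h : NodeAdjacent G G') :
    |f G - f G'| ≤ localSensitivity f G :=
  le_ciSup (f := fun G' : {G' : SimpleGraph (Fin n) // NodeAdjacent G G'} => |f G - f G'|)
    (Set.finite_range _).bddAbove ⟨G', h⟩

end LocalSensitivity

/-! ### Smoothness and size of the noise scale. -/

section NoiseScale

variable {n : ℕ}

theorem betaParam_pos {ε kstar : ℝ} (hε : 0 < ε) (hk : 0 ≤ kstar) : 0 < betaParam ε kstar := by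
  unfold betaParam
  split
  · exact hε
  · have : 0 < kstar := lt_of_le_of_ne hk (Ne.symm ‹_›)
    positivity

theorem betaParam_le (ε kstar : ℝ) : betaParam ε kstar ≤ ε := by
  unfold betaParam
  split
  · exact le_rfl
  · exact min_le_left _ _

theorem sensitivityBound_pos {kstar β x : ℝ} (hk : 0 ≤ kstar) (hβ : 0 < β) (hx : 0 ≤ x) :
    0 < sensitivityBound kstar β x := by
  unfold sensitivityBound
  positivity

theorem sensitivityBound_mono {kstar β x y : ℝ} (hk : 0 ≤ kstar) (hβ : 0 < β) (hx : 0 ≤ x)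
    (hxy : x ≤ y) : sensitivityBound kstar β x ≤ sensitivityBound kstar β y := by
  unfold sensitivityBound
  have : 0 ≤ y := hx.trans hxy
  gcongr

/-- With y = βl, the bound g(x + l) is quadratic in y, so 1 + y + y²/2 ≤ e^y absorbs it. The right
side is free of l: it bounds the supremum defining s and estimates its size. -/
theorem exp_neg_mul_sensitivityBound_le {kstar β x l : ℝ} (hk : 0 ≤ kstar) (hβ : 0 < β)
    (hx : 0 ≤ x) (hl : 0 ≤ l) :
    Real.exp (-β * l) * sensitivityBound kstar β (x + l)
      ≤ (x + kstar) * (2 + β * x) + x + 4 / β := by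
  have hy : 0 ≤ β * l := by positivity
  have hq := Real.quadratic_le_exp_of_nonneg hy
  rw [neg_mul, Real.exp_neg, inv_mul_le_iff₀ (Real.exp_pos _)]
  refine le_trans ?_ (mul_le_mul_of_nonneg_right hq (by positivity))
  obtain ⟨y, rfl⟩ : ∃ y, l = y / β := ⟨β * l, by field_simp⟩
  have e : β * (y / β) = y := by field_simp
  rw [sensitivityBound, mul_add β, e]
  rw [e] at hy
  have hb : 0 ≤ 1 / β := by positivity
  have e1 : y / β = y * (1 / β) := by ring
  have e2 : 4 / β = 4 * (1 / β) := by ring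
  have e3 : β * (1 / β) = 1 := by field_simp
  rw [e1, e2]
  generalize 1 / β = b at *
  have h1 : 0 ≤ x * y := by positivity
  have h2 : (x + y * b + kstar) * (1 + (β * x + y)) + b
      = (x + kstar) * (1 + β * x) + (x + kstar) * y + y * b + x * y * (β * b) + y ^ 2 * b + b := by
    ring
  rw [h2, e3]
  have hA : 0 ≤ (x + kstar) := by positivity
  have hB : 0 ≤ (x + kstar) * (β * x) := by positivity
  have hyb : 0 ≤ y * b := by positivity
  have hyyb : 0 ≤ y ^ 2 * b := by positivity
  have p1 : 0 ≤ (x + kstar) * y ^ 2 := by positivity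
  have p2 : 0 ≤ (x + kstar) * (β * x) * y := by positivity
  have p3 : 0 ≤ (x + kstar) * (β * x) * y ^ 2 := by positivity
  have p4 : 0 ≤ x * y ^ 2 := by positivity
  have p5 : 0 ≤ (x + kstar) * y := by positivity
  nlinarith

/-- An unbounded real supremum would take the default value 0, so every lower bound on s needs this.
-/
theorem bddAbove_noiseScale {c kstar β : ℝ} (hc : 0 ≤ c) (hk : 0 ≤ kstar) (hβ : 0 < β)
    (G : SimpleGraph (Fin n)) :
    BddAbove (Set.range fun l : ℕ => c * Real.exp (-β * (l : ℝ))
      * sensitivityBound kstar β ((kParam kstar G : ℝ) + (l : ℝ))) := by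
  refine ⟨c * (((kParam kstar G : ℝ) + kstar) * (2 + β * (kParam kstar G : ℝ))
    + (kParam kstar G : ℝ) + 4 / β), Set.forall_mem_range.2 fun l => ?_⟩
  rw [mul_assoc]
  exact mul_le_mul_of_nonneg_left
    (exp_neg_mul_sensitivityBound_le hk hβ (Nat.cast_nonneg _) (Nat.cast_nonneg _)) hc

theorem mul_sensitivityBound_le_noiseScale {c kstar β : ℝ} (hc : 0 ≤ c) (hk : 0 ≤ kstar)
    (hβ : 0 < β) (G : SimpleGraph (Fin n)) :
    c * sensitivityBound kstar β (kParam kstar G : ℝ) ≤ noiseScale c kstar β G := by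
  simpa [noiseScale] using le_ciSup (bddAbove_noiseScale hc hk hβ G) 0

theorem noiseScale_pos {c kstar β : ℝ} (hc : 0 < c) (hk : 0 ≤ kstar) (hβ : 0 < β)
    (G : SimpleGraph (Fin n)) : 0 < noiseScale c kstar β G :=
  (mul_pos hc (sensitivityBound_pos hk hβ (Nat.cast_nonneg _))).trans_le
    (mul_sensitivityBound_le_noiseScale hc.le hk hβ G)

/-- Since k_G ≤ k_{G'} + 1, the term ℓ for G is dominated by the term ℓ + 1 for G', at the price of
one factor e^β. -/
theorem noiseScale_le_exp_mul (hn : 2 ≤ n) {c kstar β : ℝ} (hc : 0 ≤ c) (hk : 0 ≤ kstar)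
    (hβ : 0 < β) {G G' : SimpleGraph (Fin n)} (h : NodeAdjacent G G') :
    noiseScale c kstar β G ≤ Real.exp β * noiseScale c kstar β G' := by
  have hkp : (kParam kstar G : ℝ) ≤ kParam kstar G' + 1 := by
    exact_mod_cast kParam_le_succ hn kstar h.symm
  refine ciSup_le fun l => ?_
  have h1 := le_ciSup (bddAbove_noiseScale hc hk hβ G') (l + 1)
  refine le_trans ?_ (mul_le_mul_of_nonneg_left h1 (Real.exp_pos _).le)
  have e : Real.exp β * (c * Real.exp (-β * ((l + 1 : ℕ) : ℝ))
      * sensitivityBound kstar β ((kParam kstar G' : ℝ) + ((l + 1 : ℕ) : ℝ)))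
      = c * Real.exp (-β * l)
        * sensitivityBound kstar β ((kParam kstar G' : ℝ) + ((l + 1 : ℕ) : ℝ)) := by
    have : Real.exp (-β * (l : ℝ)) = Real.exp β * Real.exp (-β * ((l + 1 : ℕ) : ℝ)) := by
      rw [← Real.exp_add]
      push_cast
      ring_nf
    rw [this]
    ring
  rw [e]
  refine mul_le_mul_of_nonneg_left ?_ (by positivity)
  refine sensitivityBound_mono hk hβ (by positivity) ?_
  push_cast
  linarith

theorem isSmoothUpperBound_noiseScale (hn : 2 ≤ n) {c kstar β : ℝ} (hc : 400 ≤ c)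
    (hk : 0 ≤ kstar) (hβ : 0 < β) :
    IsSmoothUpperBound (n := n) β (reweightedCount kstar β) (noiseScale c kstar β) := by
  refine ⟨fun G => ?_, fun G G' h => noiseScale_le_exp_mul hn (by linarith) hk hβ h⟩
  refine (isSensitivityConstant_four_hundred n hn kstar β hk hβ G).trans (le_trans ?_
    (mul_sensitivityBound_le_noiseScale (by linarith) hk hβ G))
  exact mul_le_mul_of_nonneg_right hc (sensitivityBound_pos hk hβ (Nat.cast_nonneg _)).le

theorem kParam_eq_one_of_isConcentrated (hn : 2 ≤ n) {k kstar : ℝ} (hkk : k ≤ kstar)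
    {G : SimpleGraph (Fin n)} (h : IsConcentrated k G) :
    kParam kstar G = 1 ∧ ∀ v, (nodeDegree G v : ℝ) ∈ degreeInterval kstar (kParam kstar G) G := by
  have hmem : ∀ j v, (nodeDegree G v : ℝ) ∈ degreeInterval kstar j G := by
    intro j v
    have h1 := h v
    rw [← avgDegree_eq hn] at h1
    have h2 : (0 : ℝ) ≤ j := Nat.cast_nonneg _
    exact ⟨by linarith [h1.1], by linarith [h1.2]⟩
  refine ⟨le_antisymm (Nat.sInf_le ⟨one_pos, ?_⟩) (kParam_spec kstar G).1, fun v => hmem _ v⟩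
  simp [hmem]

/-- For k* ≥ 1 the choice of β gives β ≤ 1 and 1/β ≤ 1/ε + k*. With k_G = 1 the uniform bound is
then at most 3(1 + k*) + 1 + 4(1/ε + k*). -/
theorem noiseScale_le_of_isConcentrated (hn : 2 ≤ n) {c ε k kstar : ℝ} (hc : 0 ≤ c) (hε : 0 < ε)
    (hk : 1 ≤ k) (hkk : k ≤ kstar) {G : SimpleGraph (Fin n)} (h : IsConcentrated k G) :
    noiseScale c kstar (betaParam ε kstar) G ≤ c * (11 * kstar + 4 / ε) := by
  have hk1 : 1 ≤ kstar := hk.trans hkk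
  have hs1 : 1 ≤ Real.sqrt kstar := Real.one_le_sqrt.2 hk1
  have hs2 : Real.sqrt kstar ≤ kstar := by
    nlinarith [Real.mul_self_sqrt (zero_le_one.trans hk1)]
  have hβ := betaParam_pos hε (zero_le_one.trans hk1)
  have hβeq : betaParam ε kstar = min ε (1 / Real.sqrt kstar) := if_neg (by linarith)
  have hβ1 : betaParam ε kstar ≤ 1 := by
    rw [hβeq]
    exact (min_le_right _ _).trans (div_le_one_of_le₀ hs1 (by positivity))
  have hβinv : 1 / betaParam ε kstar ≤ 1 / ε + kstar := by
    have h0 : 0 < 1 / ε := by positivity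
    rw [hβeq]
    rcases min_choice ε (1 / Real.sqrt kstar) with e | e
    · rw [e]; linarith
    · rw [e, one_div_one_div]; linarith
  refine ciSup_le fun l => ?_
  rw [mul_assoc]
  refine mul_le_mul_of_nonneg_left ?_ hc
  refine (exp_neg_mul_sensitivityBound_le (zero_le_one.trans hk1) hβ (Nat.cast_nonneg _)
    (Nat.cast_nonneg _)).trans ?_
  rw [(kParam_eq_one_of_isConcentrated hn hkk h).1]
  have e1 : 4 / betaParam ε kstar = 4 * (1 / betaParam ε kstar) := by ring
  have e2 : 4 / ε = 4 * (1 / ε) := by ring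
  rw [e1, e2, Nat.cast_one]
  nlinarith

end NoiseScale

/-! ### Student's distribution: total mass, second moment, stability under affine maps. -/

theorem studentT3Density_pos (z : ℝ) : 0 < studentT3Density z := by
  unfold studentT3Density
  positivity

theorem continuous_studentT3Density : Continuous studentT3Density := by
  unfold studentT3Density
  refine Continuous.div (by fun_prop) (by fun_prop) fun z => ?_
  positivity

theorem studentT3Density_le (z : ℝ) : studentT3Density z ≤ (1 + z ^ 2)⁻¹ := by
  have h3 : (1 : ℝ) ≤ Real.sqrt 3 := Real.one_le_sqrt.2 (by norm_num)
  have hp := Real.pi_gt_three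
  have h1 : 3 ≤ Real.sqrt 3 * Real.pi := by nlinarith
  unfold studentT3Density
  rw [inv_eq_one_div, div_le_div_iff₀ (by positivity) (by positivity)]
  have h2 := mul_le_mul_of_nonneg_right h1 (sq_nonneg (1 + z ^ 2 / 3))
  nlinarith [sq_nonneg z, sq_nonneg (z ^ 2)]

theorem integrable_studentT3Density : Integrable studentT3Density := by
  refine integrable_inv_one_add_sq.mono' continuous_studentT3Density.aestronglyMeasurable
    (Filter.Eventually.of_forall fun z => ?_)
  rw [Real.norm_of_nonneg (studentT3Density_pos z).le]
  exact studentT3Density_le z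

theorem integral_studentT3Density : ∫ z, studentT3Density z = 1 := by
  have hs : Real.sqrt 3 ^ 2 = 3 := Real.sq_sqrt (by norm_num)
  have hs0 : 0 < Real.sqrt 3 := by positivity
  -- Explicit antiderivative in w = z/√3. The rational part vanishes at ±∞ and the arctangent
  -- contributes π/2 at each end.
  have hderiv : ∀ z : ℝ, HasDerivAt
      (fun z : ℝ => (1 / Real.pi) * (Real.arctan (z / Real.sqrt 3)
        + (z / Real.sqrt 3) / (1 + (z / Real.sqrt 3) ^ 2))) (studentT3Density z) z := by
    intro z
    have h1 : HasDerivAt (fun z : ℝ => z / Real.sqrt 3) (1 / Real.sqrt 3) z :=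
      (hasDerivAt_id z).div_const _
    have h2 := h1.arctan
    have h3 : HasDerivAt (fun z : ℝ => 1 + (z / Real.sqrt 3) ^ 2) _ z :=
      (h1.pow 2).const_add 1
    have h4 := h1.div h3 (by positivity)
    refine ((h2.add h4).const_mul (1 / Real.pi)).congr_deriv ?_
    have e : z ^ 2 / 3 = (z / Real.sqrt 3) ^ 2 := by rw [div_pow, hs]
    rw [studentT3Density, e]
    have h5 : (1 + (z / Real.sqrt 3) ^ 2) ≠ 0 := by positivity
    generalize z / Real.sqrt 3 = w at *
    field_simp
    push_cast
    ring
  have hfrac : Filter.Tendsto (fun w : ℝ => w / (1 + w ^ 2)) (Bornology.cobounded ℝ) (nhds 0) := by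
    refine squeeze_zero_norm (a := fun w : ℝ => ‖w⁻¹‖) (fun w => ?_) ?_
    · rw [norm_div, norm_inv, Real.norm_of_nonneg (by positivity : (0 : ℝ) ≤ 1 + w ^ 2)]
      rcases eq_or_ne w 0 with rfl | hw
      · simp
      · have : 0 < ‖w‖ := norm_pos_iff.2 hw
        rw [inv_eq_one_div, div_le_div_iff₀ (by positivity) this, Real.norm_eq_abs,
          abs_mul_abs_self]
        nlinarith
    · simpa using (Filter.tendsto_inv₀_cobounded (α := ℝ)).norm
  have htop : Filter.Tendsto (fun z : ℝ => z / Real.sqrt 3) Filter.atTop Filter.atTop :=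
    Filter.tendsto_id.atTop_div_const hs0
  have hbot : Filter.Tendsto (fun z : ℝ => z / Real.sqrt 3) Filter.atBot Filter.atBot :=
    Filter.tendsto_id.atBot_div_const hs0
  have hT := (((Real.tendsto_arctan_atTop.mono_right nhdsWithin_le_nhds).comp htop).add
    (hfrac.comp (htop.mono_right IsOrderBornology.atTop_le_cobounded))).const_mul (1 / Real.pi)
  have hB := (((Real.tendsto_arctan_atBot.mono_right nhdsWithin_le_nhds).comp hbot).add
    (hfrac.comp (hbot.mono_right IsOrderBornology.atBot_le_cobounded))).const_mul (1 / Real.pi)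
  rw [integral_of_hasDerivAt_of_tendsto hderiv integrable_studentT3Density hB hT]
  have := Real.pi_ne_zero
  field_simp
  ring

instance isProbabilityMeasure_studentT3 : IsProbabilityMeasure studentT3 := by
  refine ⟨?_⟩
  rw [studentT3, withDensity_apply _ MeasurableSet.univ, Measure.restrict_univ,
    ← ofReal_integral_eq_lintegral_ofReal integrable_studentT3Density
      (Filter.Eventually.of_forall fun z => (studentT3Density_pos z).le),
    integral_studentT3Density, ENNReal.ofReal_one]

theorem integrable_sq_studentT3 : Integrable (fun z : ℝ => z ^ 2) studentT3 := by
  have hm : Measurable fun z => ENNReal.ofReal (studentT3Density z) :=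
    continuous_studentT3Density.measurable.ennreal_ofReal
  rw [studentT3, integrable_withDensity_iff hm (Filter.Eventually.of_forall fun _ => by simp)]
  refine (integrable_inv_one_add_sq.const_mul 9).mono'
    ((by fun_prop : Continuous fun z : ℝ => z ^ 2).measurable.mul
      hm.ennreal_toReal).aestronglyMeasurable (Filter.Eventually.of_forall fun z => ?_)
  rw [ENNReal.toReal_ofReal (studentT3Density_pos z).le,
    Real.norm_of_nonneg (mul_nonneg (sq_nonneg z) (studentT3Density_pos z).le)]
  have h3 : (1 : ℝ) ≤ Real.sqrt 3 := Real.one_le_sqrt.2 (by norm_num)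
  have hp := Real.pi_gt_three
  have h1 : 3 ≤ Real.sqrt 3 * Real.pi := by nlinarith
  have h2 := mul_le_mul_of_nonneg_right h1 (sq_nonneg (1 + z ^ 2 / 3))
  unfold studentT3Density
  rw [← mul_div_assoc, inv_eq_one_div, ← mul_div_assoc,
    div_le_div_iff₀ (by positivity) (by positivity)]
  nlinarith [sq_nonneg z, sq_nonneg (z ^ 2)]

/-- Shifting by at most `ε` and rescaling by a factor in `[e^{-ε}, e^ε]` changes the density of
Student's distribution by a factor of at most `e^{9ε}`. -/
theorem studentT3Density_le_affine {ε τ σ : ℝ} (hε : 0 ≤ ε) (hτ : |τ| ≤ ε) (hσ : 0 < σ)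
    (hσ1 : σ ≤ Real.exp ε) (hσ2 : 1 ≤ Real.exp ε * σ) (z : ℝ) :
    studentT3Density z ≤ Real.exp (9 * ε) * (σ * studentT3Density (τ + σ * z)) := by
  have he1 : 1 + ε ≤ Real.exp ε := by linarith [Real.add_one_le_exp ε]
  have hE1 : 1 ≤ Real.exp ε := by linarith
  have e9 : Real.exp (9 * ε) = Real.exp ε ^ 9 := by rw [← Real.exp_nat_mul]; norm_num
  rw [e9]
  generalize Real.exp ε = E at *
  -- Shift and scaling each cost E² in 3 + z². Squaring the denominator gives E⁸, and the Jacobian,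
  -- through 1 ≤ Eσ, gives the ninth factor.
  have h1 : 3 + (τ + σ * z) ^ 2 ≤ E ^ 2 * (3 + (σ * z) ^ 2) := by
    -- With y = σz, twice the gap is (ε + τ)(1 − y)² + (ε − τ)(1 + y)².
    have ha : 2 * τ * (σ * z) ≤ ε * (1 + (σ * z) ^ 2) := by
      have := abs_le.1 hτ
      nlinarith [mul_nonneg (by linarith [this.1] : 0 ≤ ε + τ) (sq_nonneg (1 - σ * z)),
        mul_nonneg (by linarith [this.2] : 0 ≤ ε - τ) (sq_nonneg (1 + σ * z))]
    have hb : τ ^ 2 ≤ ε ^ 2 := sq_le_sq' (abs_le.1 hτ).1 (abs_le.1 hτ).2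
    have hc : (1 + ε) ^ 2 * (3 + (σ * z) ^ 2) ≤ E ^ 2 * (3 + (σ * z) ^ 2) := by gcongr
    nlinarith [mul_nonneg hε (sq_nonneg (σ * z)), mul_nonneg (sq_nonneg ε) (sq_nonneg (σ * z))]
  have h2 : 3 + (σ * z) ^ 2 ≤ E ^ 2 * (3 + z ^ 2) := by
    have ha : σ ^ 2 ≤ E ^ 2 := by gcongr
    have hb : 1 ≤ E ^ 2 := one_le_pow₀ hE1
    nlinarith [mul_le_mul_of_nonneg_right ha (sq_nonneg z)]
  have h3 : 1 + (τ + σ * z) ^ 2 / 3 ≤ E ^ 4 * (1 + z ^ 2 / 3) := by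
    have := mul_le_mul_of_nonneg_left h2 (sq_nonneg E)
    have e : E ^ 4 * (1 + z ^ 2 / 3) = E ^ 2 * (E ^ 2 * (3 + z ^ 2)) / 3 := by ring
    rw [e]
    linarith
  have h4 : (1 + (τ + σ * z) ^ 2 / 3) ^ 2 ≤ E ^ 9 * σ * (1 + z ^ 2 / 3) ^ 2 := by
    calc (1 + (τ + σ * z) ^ 2 / 3) ^ 2 ≤ (E ^ 4 * (1 + z ^ 2 / 3)) ^ 2 := by gcongr
      _ = 1 * (E ^ 8 * (1 + z ^ 2 / 3) ^ 2) := by ring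
      _ ≤ (E * σ) * (E ^ 8 * (1 + z ^ 2 / 3) ^ 2) := by gcongr
      _ = _ := by ring
  unfold studentT3Density
  rw [← mul_assoc, ← mul_div_assoc, div_le_div_iff₀ (by positivity) (by positivity)]
  have hc : 0 ≤ Real.sqrt 3 * Real.pi := by positivity
  nlinarith [mul_le_mul_of_nonneg_left h4 hc]

theorem map_volume_affine (τ : ℝ) {σ : ℝ} (hσ : 0 < σ) :
    ENNReal.ofReal σ • Measure.map (fun z : ℝ => τ + σ * z) volume = volume := by
  have e : (fun z : ℝ => τ + σ * z) = (fun x => τ + x) ∘ fun z => σ * z := rfl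
  rw [e, ← Measure.map_map (by fun_prop) (by fun_prop), ← Measure.map_smul]
  have h := Real.smul_map_volume_mul_left hσ.ne'
  rw [abs_of_pos hσ] at h
  rw [h, map_add_left_eq_self]

theorem studentT3_preimage_affine_le {ε τ σ : ℝ} (hε : 0 ≤ ε) (hτ : |τ| ≤ ε) (hσ : 0 < σ)
    (hσ1 : σ ≤ Real.exp ε) (hσ2 : 1 ≤ Real.exp ε * σ) {R : Set ℝ} (hR : MeasurableSet R) :
    studentT3 ((fun z : ℝ => τ + σ * z) ⁻¹' R) ≤ ENNReal.ofReal (Real.exp (9 * ε)) * studentT3 R := by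
  have hL : Measurable fun z : ℝ => τ + σ * z := by fun_prop
  have hm : Measurable fun z => ENNReal.ofReal (studentT3Density z) :=
    continuous_studentT3Density.measurable.ennreal_ofReal
  rw [studentT3, withDensity_apply _ (hL hR), withDensity_apply _ hR]
  -- Substituting τ + σz on the right makes both sides integrals over the same preimage, where the
  -- densities compare pointwise.
  nth_rewrite 2 [← map_volume_affine τ hσ]
  rw [Measure.restrict_smul, lintegral_smul_measure, setLIntegral_map hR hm hL, smul_eq_mul,
    ← lintegral_const_mul' _ _ ENNReal.ofReal_ne_top,
    ← lintegral_const_mul' _ _ ENNReal.ofReal_ne_top]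
  refine lintegral_mono fun z => ?_
  rw [← ENNReal.ofReal_mul hσ.le, ← ENNReal.ofReal_mul (Real.exp_pos _).le]
  exact ENNReal.ofReal_le_ofReal (studentT3Density_le_affine hε hτ hσ hσ1 hσ2 z)

theorem measurable_affine (a N b : ℝ) : Measurable fun z : ℝ => N * (a + b * z) := by
  fun_prop

/-! ### Privacy, accuracy, and the main theorem. -/

theorem isNodeDP_edgeDensityEstimator {n : ℕ} (hn : 2 ≤ n) {c ε kstar : ℝ} (hc : 400 ≤ c)
    (hε : 0 < ε) (hk : 0 ≤ kstar) :
    IsNodeDP (n := n) (9 * ε) 0 (edgeDensityEstimator c ε kstar) := by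
  intro G G' h R hR
  have hβ := betaParam_pos hε hk
  have hc0 : 0 < c := by linarith
  have hS := isSmoothUpperBound_noiseScale hn hc hk hβ
  have hs := noiseScale_pos hc0 hk hβ G
  have hs' := noiseScale_pos hc0 hk hβ G'
  have h1 := hS.2 G G' h
  have h2 := hS.2 G' G h.symm
  -- The sensitivity is taken at G', since the shift below is measured in units of s'.
  have h3 := (abs_sub_le_localSensitivity (reweightedCount kstar (betaParam ε kstar))
    h.symm).trans (hS.1 G')
  have hexp := Real.exp_le_exp.2 (betaParam_le ε kstar)
  have h1 := h1.trans (mul_le_mul_of_nonneg_right hexp hs'.le)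
  have h2 := h2.trans (mul_le_mul_of_nonneg_right hexp hs.le)
  unfold edgeDensityEstimator
  rw [Measure.map_apply (measurable_affine _ _ _) hR, Measure.map_apply (measurable_affine _ _ _) hR,
    ENNReal.ofReal_zero, add_zero]
  generalize noiseScale c kstar (betaParam ε kstar) G = s at *
  generalize noiseScale c kstar (betaParam ε kstar) G' = s' at *
  generalize reweightedCount kstar (betaParam ε kstar) G = f at *
  generalize reweightedCount kstar (betaParam ε kstar) G' = f' at *
  have hτ : |(f - f') * ε / s'| ≤ ε := by
    rw [abs_div, abs_mul, abs_of_pos hε, abs_of_pos hs', div_le_iff₀ hs', abs_sub_comm, mul_comm]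
    exact mul_le_mul_of_nonneg_left h3 hε.le
  have hσ1 : s / s' ≤ Real.exp ε := (div_le_iff₀ hs').2 h1
  have hσ2 : 1 ≤ Real.exp ε * (s / s') := by
    rw [← mul_div_assoc, le_div_iff₀ hs', one_mul]
    exact h2
  -- The output for G at noise z is the output for G' at noise τ + σz, with τ = (f − f')ε/s' and σ =
  -- s/s'.
  have e : (fun z : ℝ => 1 / (n.choose 2 : ℝ) * (f + s / ε * z)) ⁻¹' R =
      (fun z : ℝ => (f - f') * ε / s' + s / s' * z) ⁻¹'
        ((fun z : ℝ => 1 / (n.choose 2 : ℝ) * (f' + s' / ε * z)) ⁻¹' R) := by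
    rw [← Set.preimage_comp]
    congr 1
    funext z
    simp only [Function.comp]
    congr 1
    field_simp
    ring
  rw [e]
  exact studentT3_preimage_affine_le hε.le hτ (div_pos hs hs') hσ1 hσ2 (measurable_affine _ _ _ hR)

/-- On a concentrated graph the error of the estimator is pure noise. -/
theorem sq_error_eq_of_isConcentrated {n : ℕ} (hn : 2 ≤ n) {c ε k kstar : ℝ}
    (hβ : 0 < betaParam ε kstar) (hkk : k ≤ kstar) {G : SimpleGraph (Fin n)}
    (h : IsConcentrated k G) (z : ℝ) :
    (edgeDensity G - 1 / (n.choose 2 : ℝ) * (reweightedCount kstar (betaParam ε kstar) G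
        + noiseScale c kstar (betaParam ε kstar) G / ε * z)) ^ 2
      = (noiseScale c kstar (betaParam ε kstar) G / (ε * n.choose 2)) ^ 2 * z ^ 2 := by
  rw [reweightedCount_eq_edgeCount hβ G (kParam_eq_one_of_isConcentrated hn hkk h).2,
    edgeDensity]
  field_simp
  ring

theorem mainTheorem1 :
    ∃ c₀ : ℝ, 0 < c₀ ∧ IsSensitivityConstant c₀ ∧
      ∀ c : ℝ, c₀ ≤ c → ∃ C : ℝ, 0 < C ∧
        (∀ n : ℕ, 2 ≤ n → ∀ ε kstar : ℝ, 0 < ε → 0 ≤ kstar →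
          IsSmoothUpperBound (n := n) (betaParam ε kstar)
            (reweightedCount kstar (betaParam ε kstar))
            (noiseScale c kstar (betaParam ε kstar)) ∧
          (∀ G : SimpleGraph (Fin n), IsProbabilityMeasure (edgeDensityEstimator c ε kstar G)) ∧
          IsNodeDP (n := n) (C * ε) 0 (edgeDensityEstimator c ε kstar)) ∧
        (∀ n : ℕ, 2 ≤ n → ∀ ε k kstar : ℝ, 0 < ε → 1 ≤ k → k ≤ kstar →
          ∀ G : SimpleGraph (Fin n), IsConcentrated k G →
            Integrable (fun y : ℝ => (edgeDensity G - y) ^ 2) (edgeDensityEstimator c ε kstar G) ∧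
            ∫ y, (edgeDensity G - y) ^ 2 ∂(edgeDensityEstimator c ε kstar G)
              ≤ C * (kstar ^ 2 / (ε ^ 2 * (n : ℝ) ^ 4) + 1 / (ε ^ 4 * (n : ℝ) ^ 4))) := by
  refine ⟨400, by norm_num, isSensitivityConstant_four_hundred, fun c hc => ?_⟩
  have hc0 : 0 < c := by linarith
  set M := ∫ z, z ^ 2 ∂studentT3 with hM
  have hM0 : 0 ≤ M := integral_nonneg fun z => sq_nonneg z
  -- The 9 serves privacy. In the error term, 16 comes from C(n,2) ≥ n²/4 squared, and 242 = 2·11²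
  -- from expanding (11k* + 4/ε)².
  refine ⟨9 + 16 * 242 * c ^ 2 * M, by positivity, fun n hn ε kstar hε hk => ⟨?_, ?_, ?_⟩,
    fun n hn ε k kstar hε hk hkk G hG => ?_⟩
  · exact isSmoothUpperBound_noiseScale hn hc hk (betaParam_pos hε hk)
  · exact fun G => Measure.isProbabilityMeasure_map (measurable_affine _ _ _).aemeasurable
  · intro G G' h R hR
    refine (isNodeDP_edgeDensityEstimator hn hc hε hk G G' h R hR).trans ?_
    have : 9 * ε ≤ (9 + 16 * 242 * c ^ 2 * M) * ε := by
      have : 0 ≤ 16 * 242 * c ^ 2 * M * ε := by positivity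
      linarith
    gcongr
  · have hβ := betaParam_pos hε (zero_le_one.trans (hk.trans hkk))
    have herr := sq_error_eq_of_isConcentrated hn (c := c) hβ hkk hG
    have hmap := measurable_affine (reweightedCount kstar (betaParam ε kstar) G)
      (1 / (n.choose 2 : ℝ)) (noiseScale c kstar (betaParam ε kstar) G / ε)
    have hcont : Continuous fun y : ℝ => (edgeDensity G - y) ^ 2 := by fun_prop
    have hs := noiseScale_le_of_isConcentrated hn hc0.le hε hk hkk hG
    have hs0 := noiseScale_pos hc0 (zero_le_one.trans (hk.trans hkk)) hβ G
    unfold edgeDensityEstimator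
    rw [integrable_map_measure hcont.aestronglyMeasurable hmap.aemeasurable,
      integral_map hmap.aemeasurable hcont.aestronglyMeasurable]
    simp only [Function.comp_def, herr]
    refine ⟨integrable_sq_studentT3.const_mul _, ?_⟩
    rw [integral_const_mul, ← hM]
    generalize noiseScale c kstar (betaParam ε kstar) G = s at *
    have hn2 : (2 : ℝ) ≤ n := by exact_mod_cast hn
    have hN : (n : ℝ) ^ 2 / 4 ≤ (n.choose 2 : ℝ) := by
      rw [Nat.cast_choose_two]
      nlinarith
    have hbound : s / (ε * n.choose 2) ≤ c * (11 * kstar + 4 / ε) / (ε * ((n : ℝ) ^ 2 / 4)) := by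
      gcongr
      exact hs0.le.trans hs
    have hk1 : 0 < kstar := by linarith
    calc (s / (ε * n.choose 2)) ^ 2 * M
        ≤ (c * (11 * kstar + 4 / ε) / (ε * ((n : ℝ) ^ 2 / 4))) ^ 2 * M := by gcongr
      _ = 16 * c ^ 2 * M / (ε ^ 2 * (n : ℝ) ^ 4) * (11 * kstar + 4 / ε) ^ 2 := by
        field_simp
        ring
      _ ≤ 16 * c ^ 2 * M / (ε ^ 2 * (n : ℝ) ^ 4) * (242 * (kstar ^ 2 + (1 / ε) ^ 2)) := by
        gcongr
        have e : 4 / ε = 4 * (1 / ε) := by ring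
        rw [e]
        nlinarith [sq_nonneg (11 * kstar - 4 * (1 / ε)), sq_nonneg (1 / ε)]
      _ = 16 * 242 * c ^ 2 * M * (kstar ^ 2 / (ε ^ 2 * (n : ℝ) ^ 4) + 1 / (ε ^ 4 * (n : ℝ) ^ 4)) := by
        field_simp
      _ ≤ _ := by
        gcongr
        linarith
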